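/- Let \((K,\delta)\) be a complete separable metric space with Borel \(\sigma\)-algebra \(\mathcal E\), and let \(Q:K\times\mathcal E\to[0,1]\) be a transition probability function: \(Q(x,\cdot)\) is a probability measure for each \(x\in K\), and \(Q(\cdot,B)\) is measurable for each \(B\in\mathcal E\). Put \(Q^1=Q\) and \(Q^{n+1}(x,B)=\int_K Q^n(y,B)\,Q(x,dy)\). Let \(Tu(x)=\int_K u(y)\,Q(x,dy)\) and let \(T^0u=u\). Let \(C[K]\) be the set of bounded continuous functions \(u:K\to\mathbb R\). Put \[\gamma(u)=\sup\Big\{\frac{|u(x)-u(y)|}{\delta(x,y)}:x,y\in K,\ x\ne y\Big\}\] (with \(\gamma(u)=0\) if \(K\) is a single point), \(\mathrm{Lip}[K]=\{u\in C[K]:\gamma(u)<\infty\}\), \(\mathrm{osc}_A(u)=\sup\{u(x)-u(y):x,y\in A\}\) for nonempty \(A\subseteq K\), and \(\mathrm{osc}(u)=\mathrm{osc}_K(u)\). The function \(Q\) is called Feller continuous if \(Tu\in C[K]\) for all \(u\in C[K]\). It has the shrinking property if for every \(\rho>0\) there is a number \(\alpha\), \(0<\alpha<1\), such that for every nonempty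 compact \(A\subseteq K\), every \(\eta>0\) and every \(\kappa>0\) there are an integer \(N\ge 0\) and a nonempty compact \(B\subseteq K\) such that, for all integers \(n\ge N\) and all \(u\in\mathrm{Lip}[K]\), \[\mathrm{osc}_A(T^nu)\le\eta\,\gamma(u)+\kappa\,\mathrm{osc}(u)+\alpha\rho\,\gamma(u)+(1-\alpha)\,\mathrm{osc}_B(T^{n-N}u).\] It is asymptotically stable if there is a Borel probability measure \(\mu\) on \(K\) such that \[\lim_{n\to\infty}\int_K u(y)\,Q^n(x,dy)=\int_K u(y)\,\mu(dy)\qquad\text{for all }u\in C[K]\text{ and all }x\in K.\] Theorem. Suppose that \(Q\) is Feller continuous, that \(Q\) has the shrinking property, and that there is a point \(x^*\in K\) such that the sequence \(\{Q^n(x^*,\cdot):n=1,2,\dots\}\) of probability measures is tight. Then \(Q\) is asymptotically stable. Moreover, \(Q\) has exactly one invariant probability measure \(\nu\) (that is, \(\nu(B)=\int_K Q(x,B)\,\nu(dx)\) for all \(B\in\mathcal E\)), and \(\lim_{n\to\infty}\int_K u(y)\,Q^n(x,dy)=\int_K u(y)\,\nu(dy)\) for all \(u\in C[K]\) and all \(x\in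 K\). -/

import Mathlib

open Filter Topology MeasureTheory ProbabilityTheory
open scoped BoundedContinuousFunction

namespace MarkovStability

section Oscillation

variable {K : Type*}

/-- Oscillation of `u` on a set `A`: the supremum of `u x - u y` over `x, y ∈ A`. -/
noncomputable def oscOn (A : Set K) (u : K → ℝ) : ℝ :=
  sSup {r : ℝ | ∃ x ∈ A, ∃ y ∈ A, r = u x - u y}

/-- Oscillation of `u` on the whole space. -/
noncomputable def osc (u : K → ℝ) : ℝ :=
  oscOn Set.univ u

/-- The difference quotients `|u x - u y| / dist x y`, `x ≠ y`. -/
def lipQuotients [MetricSpace K] (u : K → ℝ) : Set ℝ :=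
  {r : ℝ | ∃ x y : K, x ≠ y ∧ r = |u x - u y| / dist x y}

/-- The optimal Lipschitz constant `γ(u)` (used for Lipschitz functions only; it is `0` on a
space with at most one point). -/
noncomputable def lipConst [MetricSpace K] (u : K → ℝ) : ℝ :=
  sSup (lipQuotients u)

/-- `Lip[K]`: the bounded continuous functions `u` with `γ(u) < ∞`. -/
def IsLip [MetricSpace K] (u : K →ᵇ ℝ) : Prop :=
  BddAbove (lipQuotients u)

end Oscillation

section TransitionFunctions

variable {K : Type*} [MetricSpace K] [MeasurableSpace K]

/-- The transition operator `T u (x) = ∫ u(y) Q(x, dy)`. Its iterate `T^n` is `(transOp Q)^[n]`. -/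
noncomputable def transOp (Q : Kernel K K) (u : K → ℝ) : K → ℝ :=
  fun x => ∫ y, u y ∂(Q x)

/-- The `n`-step transition function: `Q^0(x, ·)` is the Dirac mass at `x` and
`Q^(n+1)(x, B) = ∫ Q^n(y, B) Q(x, dy)`. -/
noncomputable def stepKernel (Q : Kernel K K) : ℕ → Kernel K K
  | 0 => Kernel.id
  | n + 1 => stepKernel Q n ∘ₖ Q

/-- Feller continuity: `T` maps bounded continuous functions to bounded continuous functions. -/
def FellerContinuous (Q : Kernel K K) : Prop :=
  ∀ u : K →ᵇ ℝ, ∃ v : K →ᵇ ℝ, ⇑v = transOp Q u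

/-- The shrinking property. The integer `N` and the compact set `B` depend on `ρ, α, A, η, κ`
but not on `u` or `n`; the number `α` depends on `ρ` only. -/
def ShrinkingProperty (Q : Kernel K K) : Prop :=
  ∀ ρ : ℝ, 0 < ρ → ∃ α : ℝ, 0 < α ∧ α < 1 ∧
    ∀ A : Set K, A.Nonempty → IsCompact A →
      ∀ η : ℝ, 0 < η → ∀ κ : ℝ, 0 < κ →
        ∃ N : ℕ, ∃ B : Set K, B.Nonempty ∧ IsCompact B ∧
          ∀ n : ℕ, N ≤ n → ∀ u : K →ᵇ ℝ, IsLip u →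
            oscOn A ((transOp Q)^[n] u) ≤
              η * lipConst u + κ * osc u + α * ρ * lipConst u
                + (1 - α) * oscOn B ((transOp Q)^[n - N] u)

/-- The `n`-step laws from every starting point converge weakly to `μ`. -/
def ConvergesTo (Q : Kernel K K) (μ : ProbabilityMeasure K) : Prop :=
  ∀ (u : K →ᵇ ℝ) (x : K),
    Tendsto (fun n : ℕ => ∫ y, u y ∂(stepKernel Q n x)) atTop (𝓝 (∫ y, u y ∂(μ : Measure K)))

/-- Asymptotic stability: the `n`-step laws converge weakly to one probability measure,
the same for all starting points. -/
def AsymptoticallyStable (Q : Kernel K K) : Prop :=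
  ∃ μ : ProbabilityMeasure K, ConvergesTo Q μ

end TransitionFunctions

end MarkovStability

namespace MarkovStability

section Oscillation

variable {K : Type*}

/-! Iterating the shrinking property makes the oscillation of `T^n u` on any compact set tend to 0
for Lipschitz `u` (`eventually_oscOn_iterate_lt`), so the limit of `T^n u` cannot depend on the
starting point. At the tight point the limit exists (`cauchySeq_iterate`), and Prokhorov's theorem
represents it as `∫ u dν` (`exists_tendsto_iterate`). Lipschitz test functions determine weak
convergence; invariance and uniqueness of `ν` follow. -/

theorem sub_le_oscOn {A : Set K} {w : K → ℝ} {C : ℝ} (hw : ∀ x, |w x| ≤ C) {x y : K}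
    (hx : x ∈ A) (hy : y ∈ A) : w x - w y ≤ oscOn A w := by
  refine le_csSup ⟨2 * C, ?_⟩ ⟨x, hx, y, hy, rfl⟩
  rintro r ⟨a, -, b, -, rfl⟩
  linarith [abs_le.1 (hw a), abs_le.1 (hw b)]

theorem abs_sub_le_oscOn {A : Set K} {w : K → ℝ} {C : ℝ} (hw : ∀ x, |w x| ≤ C) {x y : K}
    (hx : x ∈ A) (hy : y ∈ A) : |w x - w y| ≤ oscOn A w :=
  abs_sub_le_iff.2 ⟨sub_le_oscOn hw hx hy, sub_le_oscOn hw hy hx⟩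

theorem oscOn_le {A : Set K} (hA : A.Nonempty) {w : K → ℝ} {C : ℝ} (hw : ∀ x, |w x| ≤ C) :
    oscOn A w ≤ 2 * C := by
  obtain ⟨a, ha⟩ := hA
  refine csSup_le ⟨_, a, ha, a, ha, rfl⟩ ?_
  rintro r ⟨a, -, b, -, rfl⟩
  linarith [abs_le.1 (hw a), abs_le.1 (hw b)]

theorem isLip_of_lipschitzWith [MetricSpace K] {u : K →ᵇ ℝ} {L : NNReal}
    (hu : LipschitzWith L u) : IsLip u := by
  refine ⟨L, ?_⟩
  rintro r ⟨x, y, hxy, rfl⟩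
  rw [div_le_iff₀ (dist_pos.2 hxy), ← Real.dist_eq]
  exact hu.dist_le_mul x y

end Oscillation

section TransitionFunctions

variable {K : Type*} [MetricSpace K] [MeasurableSpace K] {Q : Kernel K K}

instance isMarkovKernel_stepKernel [IsMarkovKernel Q] (n : ℕ) :
    IsMarkovKernel (stepKernel Q n) := by
  induction n with
  | zero => exact inferInstanceAs (IsMarkovKernel Kernel.id)
  | succ n ih => exact inferInstanceAs (IsMarkovKernel (stepKernel Q n ∘ₖ Q))

theorem integral_bind_kernel [OpensMeasurableSpace K] [IsMarkovKernel Q] (μ : Measure K)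
    [IsProbabilityMeasure μ] (u : K →ᵇ ℝ) : ∫ x, u x ∂(μ.bind Q) = ∫ x, transOp Q u x ∂μ := by
  rw [Measure.comp_eq_comp_const_apply, Kernel.integral_comp (u.integrable _), Kernel.const_apply]
  rfl

theorem FellerContinuous.exists_iterate [IsMarkovKernel Q] (hQ : FellerContinuous Q)
    (u : K →ᵇ ℝ) (n : ℕ) : ∃ v : K →ᵇ ℝ, ⇑v = (transOp Q)^[n] u ∧ ‖v‖ ≤ ‖u‖ := by
  induction n with
  | zero => exact ⟨u, rfl, le_rfl⟩
  | succ n ih =>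
    obtain ⟨v, hv, hvu⟩ := ih
    obtain ⟨w, hw⟩ := hQ v
    refine ⟨w, ?_, ?_⟩
    · rw [Function.iterate_succ_apply', ← hv, hw]
    · refine (BoundedContinuousFunction.norm_le (norm_nonneg u)).2 fun x => ?_
      rw [hw]
      refine (norm_integral_le_of_norm_le_const (C := ‖u‖)
        (.of_forall fun y => (v.norm_coe_le_norm y).trans hvu)).trans ?_
      simp

theorem FellerContinuous.abs_iterate_le [IsMarkovKernel Q] (hQ : FellerContinuous Q)
    (u : K →ᵇ ℝ) (n : ℕ) (x : K) : |(transOp Q)^[n] u x| ≤ ‖u‖ := by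
  obtain ⟨v, hv, hvu⟩ := hQ.exists_iterate u n
  rw [← hv]
  exact (v.norm_coe_le_norm x).trans hvu

theorem integral_stepKernel [OpensMeasurableSpace K] [IsMarkovKernel Q] (u : K →ᵇ ℝ) (n : ℕ)
    (x : K) : ∫ y, u y ∂(stepKernel Q n x) = (transOp Q)^[n] u x := by
  induction n generalizing x with
  | zero =>
    simp only [stepKernel, Kernel.id_apply, Function.iterate_zero, id_eq]
    exact integral_dirac' _ _ u.continuous.measurable.stronglyMeasurable
  | succ n ih =>
    rw [stepKernel, Kernel.integral_comp (u.integrable _), Function.iterate_succ_apply']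
    simp only [ih, transOp]

theorem integral_iterate_of_invariant [OpensMeasurableSpace K] [IsMarkovKernel Q]
    (hQ : FellerContinuous Q) {μ : Measure K} [IsProbabilityMeasure μ] (hμ : Kernel.Invariant Q μ)
    (u : K →ᵇ ℝ) (n : ℕ) : ∫ x, (transOp Q)^[n] u x ∂μ = ∫ x, u x ∂μ := by
  induction n with
  | zero => rfl
  | succ n ih =>
    obtain ⟨v, hv, -⟩ := hQ.exists_iterate u n
    rw [← ih, Function.iterate_succ_apply', ← hv]
    conv_rhs => rw [← hμ.def]
    rw [integral_bind_kernel]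

/-- Each use of the shrinking property multiplies the remaining oscillation by `1 - α`, so the
errors form a geometric series, bounded independently of `k`. This needs `α` not to depend on the
compact set, which changes at each use. -/
theorem ShrinkingProperty.oscOn_iterate_le [IsMarkovKernel Q] (hF : FellerContinuous Q)
    (hS : ShrinkingProperty Q) {ρ : ℝ} (hρ : 0 < ρ) :
    ∃ α : ℝ, 0 < α ∧ α < 1 ∧ ∀ (k : ℕ) (A : Set K), A.Nonempty → IsCompact A →
      ∃ M : ℕ, ∀ n, M ≤ n → ∀ u : K →ᵇ ℝ, IsLip u →
        oscOn A ((transOp Q)^[n] u) ≤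
          2 * ρ * lipConst u + ρ * osc u + (1 - α) ^ k * (2 * ‖u‖) := by
  obtain ⟨α, hα, hα', h⟩ := hS ρ hρ
  refine ⟨α, hα, hα', fun k => ?_⟩
  induction k with
  | zero =>
    refine fun A hA _ => ⟨0, fun n _ u _ => ?_⟩
    have h1 : 0 ≤ lipConst u := by
      refine Real.sSup_nonneg ?_
      rintro r ⟨x, y, -, rfl⟩
      positivity
    have h2 : 0 ≤ osc u := by
      obtain ⟨a, -⟩ := hA
      simpa [osc] using sub_le_oscOn (A := Set.univ) u.norm_coe_le_norm (Set.mem_univ a) (Set.mem_univ a)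
    have h3 := oscOn_le hA (hF.abs_iterate_le u n)
    have : 0 ≤ 2 * ρ * lipConst u + ρ * osc u := by positivity
    simpa using by linarith
  | succ k ih =>
    intro A hA hAc
    -- With `η = κ = α * ρ` the new error is `α * E`, where `E = 2 * ρ * lipConst u + ρ * osc u`,
    -- and `α * E + (1 - α) * E = E`.
    obtain ⟨N, B, hB, hBc, hN⟩ := h A hA hAc (α * ρ) (by positivity) (α * ρ) (by positivity)
    obtain ⟨M, hM⟩ := ih B hB hBc
    refine ⟨N + M, fun n hn u hu => (hN n (by omega) u hu).trans ?_⟩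
    have := mul_le_mul_of_nonneg_left (hM (n - N) (by omega) u hu) (sub_nonneg.2 hα'.le)
    rw [pow_succ]
    linarith

/-- On compact sets the oscillation of the iterates of a bounded Lipschitz function vanishes. -/
theorem ShrinkingProperty.eventually_oscOn_iterate_lt [IsMarkovKernel Q] (hF : FellerContinuous Q)
    (hS : ShrinkingProperty Q) {A : Set K} (hA : A.Nonempty) (hAc : IsCompact A) {u : K →ᵇ ℝ}
    (hu : IsLip u) {ε : ℝ} (hε : 0 < ε) :
    ∀ᶠ n in atTop, oscOn A ((transOp Q)^[n] u) < ε := by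
  obtain ⟨ρ, hρ, hρε⟩ : ∃ ρ : ℝ, 0 < ρ ∧ 2 * ρ * lipConst u + ρ * osc u < ε / 2 := by
    have hlim : Tendsto (fun ρ : ℝ => 2 * ρ * lipConst u + ρ * osc u) (𝓝[>] 0) (𝓝 0) := by
      refine Tendsto.mono_left (Continuous.tendsto' (by fun_prop) _ _ (by simp))
        nhdsWithin_le_nhds
    obtain ⟨ρ, h1, h2⟩ :=
      ((hlim.eventually_lt_const (half_pos hε)).and self_mem_nhdsWithin).exists
    exact ⟨ρ, h2, h1⟩
  obtain ⟨α, hα, hα', h⟩ := hS.oscOn_iterate_le hF hρ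
  have hlim : Tendsto (fun k : ℕ => (1 - α) ^ k * (2 * ‖u‖)) atTop (𝓝 0) := by
    simpa using (tendsto_pow_atTop_nhds_zero_of_lt_one (by linarith) (by linarith)).mul_const
      (2 * ‖u‖)
  obtain ⟨k, hk⟩ := (hlim.eventually_lt_const (half_pos hε)).exists
  obtain ⟨M, hM⟩ := h k A hA hAc
  filter_upwards [eventually_ge_atTop M] with n hn
  linarith [hM n hn u hu]

theorem tendsto_iterate_sub_iterate [IsMarkovKernel Q] (hF : FellerContinuous Q)
    (hS : ShrinkingProperty Q) {u : K →ᵇ ℝ} (hu : IsLip u) (x y : K) :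
    Tendsto (fun n => (transOp Q)^[n] u x - (transOp Q)^[n] u y) atTop (𝓝 0) := by
  rw [Metric.tendsto_nhds]
  intro ε hε
  filter_upwards [hS.eventually_oscOn_iterate_lt hF (A := {x, y}) (by simp)
    (Set.toFinite _).isCompact hu hε] with n hn
  rw [Real.dist_0_eq_abs]
  exact (abs_sub_le_oscOn (hF.abs_iterate_le u n) (by simp) (by simp)).trans_lt hn

/-- If all but a mass `p` of the law `P` is carried by `C`, the mean of `w` under `P` differs from
the value of `w` at a point of `C` by at most the oscillation on `C` plus `2 p sup |w|`. -/
theorem abs_integral_sub_le [OpensMeasurableSpace K] {P : Measure K} [IsProbabilityMeasure P]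
    {w : K →ᵇ ℝ} {D p : ℝ} (hD : ‖w‖ ≤ D) {A C : Set K} (hC : IsClosed C) (hCA : C ⊆ A) {x : K}
    (hx : x ∈ A) (hP : P.real Cᶜ ≤ p) :
    |∫ y, w y ∂P - w x| ≤ oscOn A w + 2 * D * p := by
  have hw : ∀ y, |w y| ≤ D := fun y => (w.norm_coe_le_norm y).trans hD
  have hosc : 0 ≤ oscOn A w := by simpa using sub_le_oscOn hw hx hx
  have hD0 : 0 ≤ D := (norm_nonneg w).trans hD
  have hI : Integrable (Set.indicator Cᶜ fun _ : K => 2 * D) P :=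
    (integrable_const _).indicator hC.measurableSet.compl
  have hsub : ∫ y, w y ∂P - w x = ∫ y, (w y - w x) ∂P := by
    rw [integral_sub (w.integrable P) (integrable_const _)]
    simp
  rw [hsub]
  calc |∫ y, (w y - w x) ∂P|
      ≤ ∫ y, |w y - w x| ∂P := abs_integral_le_integral_abs
    _ ≤ ∫ y, (oscOn A w + Set.indicator Cᶜ (fun _ => 2 * D) y) ∂P := by
        refine integral_mono ((w.integrable P).sub (integrable_const _)).abs
          ((integrable_const _).add hI) fun y => ?_
        by_cases hy : y ∈ C
        · simpa [hy] using abs_sub_le_oscOn hw (hCA hy) hx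
        · have := (abs_sub (w y) (w x)).trans (add_le_add (hw y) (hw x))
          simp only [Set.mem_compl_iff, hy, not_false_eq_true, Set.indicator_of_mem]
          linarith
    _ = oscOn A w + 2 * D * P.real Cᶜ := by
        rw [integral_add (integrable_const _) hI,
          integral_indicator_const _ hC.measurableSet.compl]
        simp [mul_comm]
    _ ≤ oscOn A w + 2 * D * p := by gcongr

/-- `T^(N+m) u (x)` is the mean of `T^N u` under `Q^m(x, ·)`. By tightness most of this law sits,
uniformly in `m ≥ 1`, on one compact set, where `T^N u` is nearly constant. -/
theorem cauchySeq_iterate [OpensMeasurableSpace K] [IsMarkovKernel Q] (hF : FellerContinuous Q)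
    (hS : ShrinkingProperty Q) {x : K}
    (hT : IsTightMeasureSet {m : Measure K | ∃ n : ℕ, 1 ≤ n ∧ m = stepKernel Q n x})
    {u : K →ᵇ ℝ} (hu : IsLip u) : CauchySeq fun n => (transOp Q)^[n] u x := by
  rw [Metric.cauchySeq_iff']
  intro ε hε
  -- The `+ 1` covers `u = 0`.
  set p : ℝ := ε / (4 * (‖u‖ + 1)) with hp
  have hp0 : 0 < p := by positivity
  have hup : 2 * ‖u‖ * p < ε / 2 := by
    rw [hp, mul_div_assoc', div_lt_div_iff₀ (by positivity) (by norm_num)]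
    nlinarith
  obtain ⟨C, hC, hCm⟩ := isTightMeasureSet_iff_exists_isCompact_measure_compl_le.1 hT
    (ENNReal.ofReal p) (by simpa using hp0)
  obtain ⟨N, hN⟩ := (hS.eventually_oscOn_iterate_lt hF (Set.insert_nonempty x C)
    (hC.insert x) hu (half_pos hε)).exists
  refine ⟨N, fun n hn => ?_⟩
  obtain ⟨m, rfl⟩ := Nat.exists_eq_add_of_le hn
  -- Tightness says nothing about `Q^0`.
  rcases Nat.eq_zero_or_pos m with rfl | hm
  · simpa using hε
  obtain ⟨w, hw, hwu⟩ := hF.exists_iterate u N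
  have hP : (stepKernel Q m x).real Cᶜ ≤ p :=
    ENNReal.toReal_le_of_le_ofReal hp0.le (hCm _ ⟨m, hm, rfl⟩)
  have := abs_integral_sub_le hwu hC.isClosed (Set.subset_insert x C) (Set.mem_insert x C) hP
  rw [integral_stepKernel, hw, ← Function.iterate_add_apply, add_comm m N] at this
  rw [Real.dist_eq]
  linarith

theorem exists_tendsto_iterate [BorelSpace K] [IsMarkovKernel Q] (hF : FellerContinuous Q)
    (hS : ShrinkingProperty Q) {x : K}
    (hT : IsTightMeasureSet {m : Measure K | ∃ n : ℕ, 1 ≤ n ∧ m = stepKernel Q n x}) :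
    ∃ ν : ProbabilityMeasure K, ∀ u : K →ᵇ ℝ, IsLip u →
      Tendsto (fun n => (transOp Q)^[n] u x) atTop (𝓝 (∫ y, u y ∂(ν : Measure K))) := by
  let μ : ℕ → ProbabilityMeasure K := fun n => ⟨stepKernel Q (n + 1) x, inferInstance⟩
  have hc : IsCompact (closure (Set.range μ)) := by
    refine isCompact_closure_of_isTightMeasureSet (hT.subset ?_)
    rintro _ ⟨_, ⟨n, rfl⟩, rfl⟩
    exact ⟨n + 1, by omega, rfl⟩
  obtain ⟨ν, -, hν⟩ := hc.exists_mapClusterPt (f := atTop) (u := μ)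
    (tendsto_principal.2 (.of_forall fun n => subset_closure ⟨n, rfl⟩))
  -- Along `U` the integrals of `u` tend both to `∫ u dν` and to the limit of the full Cauchy
  -- sequence.
  obtain ⟨U, hU, hUν⟩ := mapClusterPt_iff_ultrafilter.1 hν
  refine ⟨ν, fun u hu => ?_⟩
  obtain ⟨l, hl⟩ := cauchySeq_tendsto_of_complete (cauchySeq_iterate hF hS hT hu)
  have h1 := ProbabilityMeasure.tendsto_iff_forall_integral_tendsto.1 hUν u
  have h2 : Tendsto (fun n => ∫ y, u y ∂(μ n : Measure K)) U (𝓝 l) := by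
    simp only [μ, ProbabilityMeasure.coe_mk, integral_stepKernel]
    exact ((tendsto_add_atTop_iff_nat 1).2 hl).mono_left hU
  rwa [tendsto_nhds_unique h1 h2]

theorem convergesTo_of_forall_isLip [OpensMeasurableSpace K] [IsMarkovKernel Q]
    {ν : ProbabilityMeasure K}
    (h : ∀ (u : K →ᵇ ℝ) (x : K), IsLip u →
      Tendsto (fun n => (transOp Q)^[n] u x) atTop (𝓝 (∫ y, u y ∂(ν : Measure K)))) :
    ConvergesTo Q ν := by
  intro u x
  let μ : ℕ → ProbabilityMeasure K := fun n => ⟨stepKernel Q n x, inferInstance⟩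
  have hμ : Tendsto μ atTop (𝓝 ν) := by
    refine tendsto_iff_forall_lipschitz_integral_tendsto.2 ?_
    rintro f ⟨C, hC⟩ ⟨L, hL⟩
    let g : K →ᵇ ℝ := .mkOfBound ⟨f, hL.continuous⟩ C hC
    refine (h g x (isLip_of_lipschitzWith (L := L) hL)).congr fun n => ?_
    exact (integral_stepKernel g n x).symm
  exact ProbabilityMeasure.tendsto_iff_forall_integral_tendsto.1 hμ u

/-- `T^n (T u)` and `T^(n+1) u` are the same sequence, so `T u` and `u` have equal `ν`-integrals. -/
theorem ConvergesTo.invariant [BorelSpace K] [IsMarkovKernel Q] (hF : FellerContinuous Q)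
    {ν : ProbabilityMeasure K} (hν : ConvergesTo Q ν) (x : K) :
    Kernel.Invariant Q (ν : Measure K) := by
  refine ext_of_forall_integral_eq_of_IsFiniteMeasure fun u => ?_
  obtain ⟨v, hv⟩ := hF u
  have h1 := hν v x
  have h2 := (tendsto_add_atTop_iff_nat 1).2 (hν u x)
  simp only [integral_stepKernel, Function.iterate_succ_apply] at h1 h2
  rw [hv] at h1
  rw [integral_bind_kernel]
  exact tendsto_nhds_unique h1 h2

/-- `∫ T^n u dμ` is constant in `n` by invariance and tends to `∫ u dν` by dominated convergence. -/
theorem ConvergesTo.eq_of_invariant [BorelSpace K] [IsMarkovKernel Q] (hF : FellerContinuous Q)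
    {ν μ : ProbabilityMeasure K} (hν : ConvergesTo Q ν) (hμ : Kernel.Invariant Q (μ : Measure K)) :
    μ = ν := by
  refine Subtype.ext (show (μ : Measure K) = ν from
    ext_of_forall_integral_eq_of_IsFiniteMeasure fun u => ?_)
  have hlim : Tendsto (fun n => ∫ x, (transOp Q)^[n] u x ∂(μ : Measure K)) atTop
      (𝓝 (∫ _, (∫ y, u y ∂(ν : Measure K)) ∂(μ : Measure K))) := by
    refine tendsto_integral_of_dominated_convergence (fun _ => ‖u‖) (fun n => ?_)
      (integrable_const _) (fun n => .of_forall (hF.abs_iterate_le u n)) (.of_forall fun x => ?_)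
    · obtain ⟨v, hv, -⟩ := hF.exists_iterate u n
      rw [← hv]
      exact v.continuous.measurable.aestronglyMeasurable
    · simpa only [integral_stepKernel] using hν u x
  simp only [integral_iterate_of_invariant hF hμ, integral_const, probReal_univ, one_smul] at hlim
  exact tendsto_nhds_unique tendsto_const_nhds hlim

end TransitionFunctions

end MarkovStability

theorem theorem7p3 {K : Type*} [MetricSpace K] [CompleteSpace K]
    [TopologicalSpace.SeparableSpace K] [MeasurableSpace K] [BorelSpace K]
    (Q : Kernel K K) [IsMarkovKernel Q]
    (hFeller : MarkovStability.FellerContinuous Q)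
    (hShrink : MarkovStability.ShrinkingProperty Q)
    (xstar : K)
    (hTight : IsTightMeasureSet
      {m : Measure K | ∃ n : ℕ, 1 ≤ n ∧ m = MarkovStability.stepKernel Q n xstar}) :
    MarkovStability.AsymptoticallyStable Q ∧
      ∃ ν : ProbabilityMeasure K,
        Kernel.Invariant Q (ν : Measure K) ∧
        MarkovStability.ConvergesTo Q ν ∧
        ∀ μ : ProbabilityMeasure K, Kernel.Invariant Q (μ : Measure K) → μ = ν := by
  obtain ⟨ν, hν⟩ := MarkovStability.exists_tendsto_iterate hFeller hShrink hTight
  have hconv : MarkovStability.ConvergesTo Q ν := by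
    refine MarkovStability.convergesTo_of_forall_isLip fun u x hu => ?_
    simpa using
      (MarkovStability.tendsto_iterate_sub_iterate hFeller hShrink hu x xstar).add (hν u hu)
  exact ⟨⟨ν, hconv⟩, ν, hconv.invariant hFeller xstar, hconv,
    fun μ hμ => hconv.eq_of_invariant hFeller hμ⟩
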